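/- Let $\mathbb K$ be $\mathbb R$ or $\mathbb C$. For a Banach space $X$ over $\mathbb K$, a closed subspace $J\subseteq X$ and $C>0$, say that $J$ is an $M(1,C)$-ideal in $X$ if there is a bounded linear projection $Q$ on the dual $X^*$ with $\|Q\|\le 1$, with kernel $J^\perp=\{f\in X^*: f|_J=0\}$, and with $$\|Qf\|+C\,\|f-Qf\|\le\|f\|\qquad\text{for all } f\in X^*.$$ For Banach spaces $E,F$ over $\mathbb K$ and $n\ge 1$, let $\mathcal P(^nE,F)$ be the Banach space of continuous $n$-homogeneous polynomials $P\colon E\to F$ (that is, continuous maps of the form $P(x)=A(x,\dots,x)$ with $A\colon E^n\to F$ symmetric and $n$-linear), with the norm $\|P\|=\sup\{\|P(x)\|: \|x\|\le 1\}$, and let $\mathcal P_w(^nE,F)$ be its subspace of polynomials that are weakly continuous on bounded sets (that is, $P(x_\alpha)\to P(x)$ in norm whenever $(x_\alpha)$ is a bounded net in $E$ converging weakly to $x$). **Proposition.** Let $E,F$ be Banach spaces over $\mathbb K$ such that there exists a quotient mapping $\rho\colon E\to F$, that is, a continuous linear map that maps the open unit ball of $E$ onto the open unit ball of $F$. If,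 for some integer $n\ge 1$ and some $C>0$, $\mathcal P_w(^nE,F)$ is an $M(1,C)$-ideal in $\mathcal P(^nE,F)$, then $F$ (canonically embedded) is an $M(1,C)$-ideal in $F^{**}$. -/

import Mathlib

noncomputable section

section IdealStructures

variable {𝕜 X : Type*} [RCLike 𝕜] [NormedAddCommGroup X] [NormedSpace 𝕜 X]

/-- `Q` is a linear projection on `X*` with kernel the annihilator of `J` and norm at most one
(hence of norm one, unless `J = 0` and `Q = 0`). Such a `Q` makes a closed `J` an ideal in `X`. -/
structure IsIdealProjection (J : Submodule 𝕜 X)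
    (Q : StrongDual 𝕜 X →L[𝕜] StrongDual 𝕜 X) : Prop where
  idem : ∀ f, Q (Q f) = Q f
  ker_eq : ∀ f, Q f = 0 ↔ ∀ y ∈ J, f y = 0
  norm_le : ‖Q‖ ≤ 1

/-- The closed subspace `J` of `X` is an `M(1,C)`-ideal in `X`. -/
def IsMOneIdeal (𝕜 X : Type*) [RCLike 𝕜] [NormedAddCommGroup X] [NormedSpace 𝕜 X]
    (C : ℝ) (J : Submodule 𝕜 X) : Prop :=
  IsClosed (J : Set X) ∧ ∃ Q : StrongDual 𝕜 X →L[𝕜] StrongDual 𝕜 X,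
    IsIdealProjection J Q ∧ ∀ f : StrongDual 𝕜 X, ‖Q f‖ + C * ‖f - Q f‖ ≤ ‖f‖

end IdealStructures

/-- The canonical copy of `F` in its bidual. -/
def canonicalCopy (𝕜 F : Type*) [RCLike 𝕜] [NormedAddCommGroup F] [NormedSpace 𝕜 F] :
    Submodule 𝕜 (StrongDual 𝕜 (StrongDual 𝕜 F)) :=
  LinearMap.range (NormedSpace.inclusionInDoubleDual 𝕜 F : F →ₗ[𝕜] StrongDual 𝕜 (StrongDual 𝕜 F))

/-- Quotient mappings between normed spaces, in the isometric sense: `ρ` maps the open unit ball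
onto the open unit ball, so that `F` is isometric to `E / ker ρ`. -/
def IsMetricQuotientMap {𝕜 E F : Type*} [RCLike 𝕜] [NormedAddCommGroup E] [NormedSpace 𝕜 E]
    [NormedAddCommGroup F] [NormedSpace 𝕜 F] (ρ : E →L[𝕜] F) : Prop :=
  ρ '' Metric.ball 0 1 = Metric.ball 0 1

section Polynomials

variable (𝕜 : Type*) (n : ℕ) (E F : Type*) [RCLike 𝕜] [NormedAddCommGroup E] [NormedSpace 𝕜 E]
  [NormedAddCommGroup F] [NormedSpace 𝕜 F]

/-- The vector space of continuous `n`-homogeneous polynomials, as functions `E → F`. -/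
def contHomPolySubmodule : Submodule 𝕜 (E → F) where
  carrier := {P | Continuous P ∧ ∃ A : MultilinearMap 𝕜 (fun _ : Fin n => E) F,
    (∀ (σ : Equiv.Perm (Fin n)) (v : Fin n → E), A (fun i => v (σ i)) = A v) ∧
      ∀ x, P x = A (fun _ => x)}
  add_mem' := by
    rintro P Q ⟨hP, A, hA, hPA⟩ ⟨hQ, B, hB, hQB⟩
    refine ⟨hP.add hQ, A + B, fun σ v => ?_, fun x => ?_⟩
    · simp only [add_apply, hA, hB]
    · simp only [Pi.add_apply, add_apply, hPA, hQB]
  zero_mem' := ⟨continuous_zero, 0, fun _ _ => rfl, fun _ => rfl⟩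
  smul_mem' := by
    rintro c P ⟨hP, A, hA, hPA⟩
    refine ⟨hP.const_smul c, c • A, fun σ v => ?_, fun x => ?_⟩
    · simp only [smul_apply, hA]
    · simp only [Pi.smul_apply, smul_apply, hPA]

/-- The type of continuous `n`-homogeneous polynomials from `E` to `F`; it is normed below. -/
def ContHomPoly : Type _ := ↥(contHomPolySubmodule 𝕜 n E F)

namespace ContHomPoly

instance : AddCommGroup (ContHomPoly 𝕜 n E F) :=
  inferInstanceAs (AddCommGroup ↥(contHomPolySubmodule 𝕜 n E F))

instance : Module 𝕜 (ContHomPoly 𝕜 n E F) :=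
  inferInstanceAs (Module 𝕜 ↥(contHomPolySubmodule 𝕜 n E F))

variable {𝕜 n E F}

instance : CoeFun (ContHomPoly 𝕜 n E F) (fun _ => E → F) := ⟨fun P => P.1⟩

theorem ext' {P Q : ContHomPoly 𝕜 n E F} (h : ∀ x, P x = Q x) : P = Q :=
  Subtype.ext (funext h)

@[simp] theorem zero_apply (x : E) : (0 : ContHomPoly 𝕜 n E F) x = 0 := rfl

@[simp] theorem add_apply (P Q : ContHomPoly 𝕜 n E F) (x : E) : (P + Q) x = P x + Q x := rfl

@[simp] theorem neg_apply (P : ContHomPoly 𝕜 n E F) (x : E) : (-P) x = -P x := rfl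

@[simp] theorem smul_apply (c : 𝕜) (P : ContHomPoly 𝕜 n E F) (x : E) : (c • P) x = c • P x := rfl

theorem continuous (P : ContHomPoly 𝕜 n E F) : Continuous P := P.2.1

theorem map_smul (P : ContHomPoly 𝕜 n E F) (c : 𝕜) (x : E) : P (c • x) = c ^ n • P x := by
  obtain ⟨-, A, -, hA⟩ := P.2
  have h := A.map_smul_univ (fun _ => c) (fun _ => x)
  simp only [Finset.prod_const, Finset.card_univ, Fintype.card_fin] at h
  rw [hA, hA, h]

/-- The supremum of `‖P x‖` over the closed unit ball of `E`. -/
def supNorm (P : ContHomPoly 𝕜 n E F) : ℝ :=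
  sSup ((fun x => ‖P x‖) '' Metric.closedBall (0 : E) 1)

theorem bddAbove (P : ContHomPoly 𝕜 n E F) :
    BddAbove ((fun x => ‖P x‖) '' Metric.closedBall (0 : E) 1) := by
  obtain ⟨δ, hδ, h⟩ := Metric.continuousAt_iff.1 (P.continuous.continuousAt (x := (0 : E))) 1 one_pos
  have hc : (0 : ℝ) < δ / 2 := by positivity
  refine ⟨((δ / 2) ^ n)⁻¹ * (1 + ‖P 0‖), ?_⟩
  rintro _ ⟨x, hx, rfl⟩
  have hx1 : ‖x‖ ≤ 1 := by simpa using hx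
  have hn : ‖((δ / 2 : ℝ) : 𝕜)‖ = δ / 2 := by rw [RCLike.norm_ofReal, abs_of_pos hc]
  have h1 : ‖P (((δ / 2 : ℝ) : 𝕜) • x)‖ ≤ 1 + ‖P 0‖ := by
    have h2 : dist (((δ / 2 : ℝ) : 𝕜) • x) 0 < δ := by
      rw [dist_zero_right, norm_smul, hn]
      nlinarith
    have h3 := (h h2).le
    rw [dist_eq_norm] at h3
    have h4 := norm_le_norm_add_norm_sub' (P (((δ / 2 : ℝ) : 𝕜) • x)) (P 0)
    linarith
  rw [map_smul, norm_smul, norm_pow, hn] at h1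
  change ‖P x‖ ≤ _
  rw [inv_mul_eq_div, le_div_iff₀ (by positivity)]
  linarith

theorem le_supNorm (P : ContHomPoly 𝕜 n E F) {x : E} (hx : ‖x‖ ≤ 1) : ‖P x‖ ≤ P.supNorm :=
  le_csSup P.bddAbove ⟨x, by simpa using hx, rfl⟩

theorem supNorm_le (P : ContHomPoly 𝕜 n E F) {M : ℝ} (h : ∀ x, ‖x‖ ≤ 1 → ‖P x‖ ≤ M) :
    P.supNorm ≤ M := by
  refine csSup_le ⟨_, 0, by simp, rfl⟩ ?_
  rintro _ ⟨x, hx, rfl⟩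
  exact h x (by simpa using hx)

theorem eq_zero_of_supNorm (P : ContHomPoly 𝕜 n E F) (h : P.supNorm = 0) : P = 0 := by
  refine ext' fun x => ?_
  have hr : (0 : ℝ) < ‖x‖ + 1 := by positivity
  have hn : ‖((‖x‖ + 1 : ℝ) : 𝕜)‖ = ‖x‖ + 1 := by rw [RCLike.norm_ofReal, abs_of_pos hr]
  have hc : ((‖x‖ + 1 : ℝ) : 𝕜) ≠ 0 := by
    rw [← norm_pos_iff, hn]
    exact hr
  have h1 : ‖((‖x‖ + 1 : ℝ) : 𝕜)⁻¹ • x‖ ≤ 1 := by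
    rw [norm_smul, norm_inv, hn, inv_mul_eq_div, div_le_one hr]
    linarith
  have h2 : P (((‖x‖ + 1 : ℝ) : 𝕜)⁻¹ • x) = 0 := by
    rw [← norm_le_zero_iff, ← h]
    exact P.le_supNorm h1
  rw [map_smul, smul_eq_zero] at h2
  rcases h2 with h2 | h2
  · exact absurd h2 (pow_ne_zero _ (inv_ne_zero hc))
  · exact h2

/-- The Banach space norm `‖P‖ = sup {‖P x‖ : ‖x‖ ≤ 1}`. -/
instance : NormedAddCommGroup (ContHomPoly 𝕜 n E F) :=
  AddGroupNorm.toNormedAddCommGroup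
    { toFun := supNorm
      map_zero' := le_antisymm (supNorm_le _ fun x _ => by simp)
        ((norm_nonneg _).trans (le_supNorm (0 : ContHomPoly 𝕜 n E F) (x := (0 : E)) (by simp)))
      add_le' := fun P Q => supNorm_le _ fun x hx =>
        (norm_add_le _ _).trans (add_le_add (P.le_supNorm hx) (Q.le_supNorm hx))
      neg' := fun P => by simp only [supNorm, neg_apply, norm_neg]
      eq_zero_of_map_eq_zero' := fun P h => P.eq_zero_of_supNorm h }

theorem norm_def (P : ContHomPoly 𝕜 n E F) :
    ‖P‖ = sSup ((fun x => ‖P x‖) '' Metric.closedBall (0 : E) 1) := rfl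

instance : NormedSpace 𝕜 (ContHomPoly 𝕜 n E F) where
  toModule := inferInstanceAs (Module 𝕜 (ContHomPoly 𝕜 n E F))
  norm_smul_le c P := supNorm_le _ fun x hx => by
    rw [smul_apply, norm_smul]
    exact mul_le_mul_of_nonneg_left (P.le_supNorm hx) (norm_nonneg c)

end ContHomPoly

/-- The subspace of those continuous `n`-homogeneous polynomials that are weakly continuous on
bounded sets: for each norm-bounded `B`, the restriction of `P` to `B` is continuous from the
weak topology to the norm topology; in other words, `P x_α → P x` in norm for every bounded net
`x_α` that converges weakly to `x`. -/
def weaklyContPoly : Submodule 𝕜 (ContHomPoly 𝕜 n E F) where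
  carrier := {P | ∀ B : Set E, Bornology.IsBounded B →
    ContinuousOn (fun y : WeakSpace 𝕜 E => P ((toWeakSpace 𝕜 E).symm y))
      ((toWeakSpace 𝕜 E).symm ⁻¹' B)}
  add_mem' := fun hP hQ B hB => (hP B hB).add (hQ B hB)
  zero_mem' := fun _ _ => continuousOn_const
  smul_mem' := fun c _ hP B hB => (hP B hB).const_smul c

end Polynomials

end

/-! Write n = m + 1. The projection on F*** is the canonical one, sending f to the canonical
extension g of f|_F; it remains to bound C|(f - g)(η)| by (‖f‖ - ‖g‖)‖η‖ for each η in F**. Lift η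
to ξ in E** along ρ** with r = ‖ξ‖ ≤ ‖η‖, take an ultrafilter on the ball of radius r converging
weak* to ξ (Goldstine), and let L(P) in F** be the weak* limit of P along it. Then ‖L‖ ≤ r^n, L
sends ψ^n y to ξ(ψ)^n y and ψ^m ρ to ξ(ψ)^m η, and L maps weakly continuous polynomials into F
(`cauchy_map`). Pull f and g back along L (`IsMOneIdeal.transfer`). The polynomials ψ^n y show that
Q(g∘L) has norm at least r^n‖g‖, so the M(1,C) inequality forces Q(g∘L) = g∘L. As f and g agree on
F, also Q(f∘L) = g∘L. The inequality for f∘L, tested on ψ^m ρ, reads r^n‖g‖ + C r^m|(f - g)(η)| ≤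
r^n‖f‖; cancel r^m. -/

open Filter Topology

/-! ### Helly's lemma and Goldstine's theorem -/

/-- Helly's lemma: a functional on the dual is approximated on finitely many functionals
by points of a ball. -/
theorem exists_mem_closedBall_forall_dist_lt {𝕜 E : Type*} [RCLike 𝕜] [NormedAddCommGroup E]
    [NormedSpace 𝕜 E] (ξ : StrongDual 𝕜 (StrongDual 𝕜 E)) (s : Finset (StrongDual 𝕜 E))
    {ε : ℝ} (hε : 0 < ε) :
    ∃ x ∈ Metric.closedBall (0 : E) ‖ξ‖, ∀ φ ∈ s, dist (φ x) (ξ φ) < ε := by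
  classical
  let : NormedSpace ℝ E := NormedSpace.restrictScalars ℝ 𝕜 E
  have : IsScalarTower ℝ 𝕜 E := RestrictScalars.isScalarTower ℝ 𝕜 E
  let T : E →ₗ[𝕜] (s → 𝕜) := LinearMap.pi fun φ => (φ.1 : E →ₗ[𝕜] 𝕜)
  have hconv : Convex ℝ (T '' Metric.closedBall (0 : E) ‖ξ‖) :=
    (convex_closedBall (0 : E) ‖ξ‖).linear_image (T.restrictScalars ℝ)
  suffices hmem : (fun φ : s => ξ φ.1) ∈ closure (T '' Metric.closedBall (0 : E) ‖ξ‖) by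
    obtain ⟨_, ⟨x, hx, rfl⟩, hd⟩ := Metric.mem_closure_iff.1 hmem ε hε
    refine ⟨x, hx, fun φ hφ => ?_⟩
    rw [dist_comm]
    exact (dist_le_pi_dist (fun φ : s => ξ φ.1) (T x) ⟨φ, hφ⟩).trans_lt hd
  by_contra hmem
  obtain ⟨g, u, hg, hu⟩ := RCLike.geometric_hahn_banach_closed_point (𝕜 := 𝕜)
    hconv.closure isClosed_closure hmem
  -- The separating functional pulls back to a combination `ψ` of the given functionals.
  let ψ : StrongDual 𝕜 E := ∑ φ : s, g (Pi.single φ 1) • φ.1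
  have hgz (z : s → 𝕜) : g z = ∑ φ : s, g (Pi.single φ 1) * z φ := by
    have h1 : z = ∑ φ : s, z φ • (Pi.single φ 1 : s → 𝕜) := by
      simpa [Pi.single_apply] using (pi_eq_sum_univ' z)
    conv_lhs => rw [h1]
    simp [mul_comm]
  have hgT (x : E) : g (T x) = ψ x := by
    rw [hgz]
    simp [ψ, T]
  have hgξ : g (fun φ : s => ξ φ.1) = ξ ψ := by
    rw [hgz]
    simp [ψ, map_sum]
  have hball (x : E) (hx : ‖x‖ ≤ ‖ξ‖) : RCLike.re (ψ x) < u := by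
    rw [← hgT]
    exact hg _ (subset_closure ⟨x, by simpa using hx, rfl⟩)
  have hu0 : 0 < u := by simpa using hball 0 (by rw [norm_zero]; exact norm_nonneg ξ)
  have hnorm (x : E) (hx : ‖x‖ ≤ ‖ξ‖) : ‖ψ x‖ ≤ u := by
    by_cases h0 : ψ x = 0
    · simp [h0, hu0.le]
    -- Rotating `x` by a unimodular scalar turns the bound on the real part into one on the modulus.
    · obtain ⟨c, hc, hcx⟩ : ∃ c : 𝕜, ‖c‖ = 1 ∧ c * ψ x = (‖ψ x‖ : 𝕜) := by
        obtain ⟨c, hc, h⟩ := RCLike.exists_norm_eq_mul_self (ψ x)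
        exact ⟨c, hc, h.symm⟩
      have := hball (c • x) (by rwa [norm_smul, hc, one_mul])
      rw [map_smul, smul_eq_mul, hcx, RCLike.ofReal_re] at this
      exact this.le
  rw [hgξ] at hu
  have h1 : ‖ξ ψ‖ ≤ u := by
    rcases eq_or_ne ξ 0 with rfl | h0
    · simpa using hu0.le
    · have h0' : 0 < ‖ξ‖ := (norm_nonneg ξ).lt_of_ne' (norm_ne_zero_iff (a := ξ) |>.2 h0)
      have h2 : ‖ψ‖ ≤ u / ‖ξ‖ :=
        ContinuousLinearMap.opNorm_bound_of_ball_bound h0' u ψ fun x hx => hnorm x (by simpa using hx)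
      calc ‖ξ ψ‖ ≤ ‖ξ‖ * ‖ψ‖ := ξ.le_opNorm ψ
        _ ≤ ‖ξ‖ * (u / ‖ξ‖) := by gcongr
        _ = u := by field_simp
  exact absurd (hu.trans_le ((RCLike.re_le_norm _).trans h1)) (lt_irrefl _)

/-- Goldstine's theorem, in terms of ultrafilters. -/
theorem exists_ultrafilter_tendsto_bidual {𝕜 E : Type*} [RCLike 𝕜] [NormedAddCommGroup E]
    [NormedSpace 𝕜 E] (ξ : StrongDual 𝕜 (StrongDual 𝕜 E)) :
    ∃ U : Ultrafilter E, Metric.closedBall (0 : E) ‖ξ‖ ∈ U ∧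
      ∀ φ : StrongDual 𝕜 E, Tendsto φ U (𝓝 (ξ φ)) := by
  have h : MapClusterPt (fun φ : StrongDual 𝕜 E => ξ φ)
      (𝓟 (Metric.closedBall (0 : E) ‖ξ‖)) (fun x φ => φ x) := by
    rw [MapClusterPt, map_principal, ← mem_closure_iff_clusterPt, mem_closure_iff]
    intro o ho hξ
    obtain ⟨s, v, hv, hvo⟩ := isOpen_pi_iff.1 ho _ hξ
    have h1 : ∀ φ ∈ s, ∃ ε > 0, Metric.ball (ξ φ) ε ⊆ v φ := fun φ hφ =>
      Metric.isOpen_iff.1 (hv φ hφ).1 _ (hv φ hφ).2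
    have h2 : ∃ ε > 0, ∀ φ ∈ s, Metric.ball (ξ φ) ε ⊆ v φ := by
      have h3 : ∀ᶠ ε in 𝓝[>] (0 : ℝ), ∀ φ ∈ s, Metric.ball (ξ φ) ε ⊆ v φ := by
        rw [eventually_all_finset]
        intro φ hφ
        obtain ⟨ε, hε, hb⟩ := h1 φ hφ
        filter_upwards [Ioo_mem_nhdsGT hε] with δ hδ
        exact (Metric.ball_subset_ball hδ.2.le).trans hb
      obtain ⟨ε, h4, h5⟩ := (h3.and self_mem_nhdsWithin).exists
      exact ⟨ε, h5, h4⟩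
    obtain ⟨ε, hε, h3⟩ := h2
    obtain ⟨x, hx, h4⟩ := exists_mem_closedBall_forall_dist_lt ξ s hε
    exact ⟨_, hvo fun φ hφ => h3 φ hφ (h4 φ hφ), x, hx, rfl⟩
  obtain ⟨U, hU, ht⟩ := mapClusterPt_iff_ultrafilter.1 h
  exact ⟨U, le_principal_iff.1 hU, fun φ => (tendsto_pi_nhds.1 ht) φ⟩

/-! ### Polynomial degree through finite differences -/

/-- Functions all of whose iterated finite differences of order `n + 1` vanish. -/
def HasDifferenceDegreeLE {G H : Type*} [Add G] [Sub H] : ℕ → (G → H) → Prop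
  | 0, f => ∀ x y, f x = f y
  | n + 1, f => ∀ h, HasDifferenceDegreeLE n fun x => f (x + h) - f x

namespace HasDifferenceDegreeLE

variable {G H : Type*} [AddCommGroup G] [AddCommGroup H]

theorem succ {n : ℕ} {f : G → H} (hf : HasDifferenceDegreeLE n f) :
    HasDifferenceDegreeLE (n + 1) f := by
  induction n generalizing f with
  | zero =>
    intro h x y
    change f (x + h) - f x = f (y + h) - f y
    rw [hf (x + h) x, hf (y + h) y, sub_self, sub_self]
  | succ n ih => exact fun h => ih (hf h)

theorem mono {m n : ℕ} (hmn : m ≤ n) {f : G → H} (hf : HasDifferenceDegreeLE m f) :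
    HasDifferenceDegreeLE n f := by
  induction n, hmn using Nat.le_induction with
  | base => exact hf
  | succ n _ ih => exact ih.succ

theorem zero (n : ℕ) : HasDifferenceDegreeLE n (fun _ : G => (0 : H)) :=
  mono (Nat.zero_le n) (m := 0) fun _ _ => rfl

theorem add {n : ℕ} {f g : G → H} (hf : HasDifferenceDegreeLE n f)
    (hg : HasDifferenceDegreeLE n g) : HasDifferenceDegreeLE n fun x => f x + g x := by
  induction n generalizing f g with
  | zero =>
    intro x y
    change f x + g x = f y + g y
    rw [hf x y, hg x y]
  | succ n ih =>
    intro h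
    have := ih (hf h) (hg h)
    simpa only [add_sub_add_comm] using this

theorem sum {ι : Type*} {n : ℕ} (s : Finset ι) {f : ι → G → H}
    (hf : ∀ i ∈ s, HasDifferenceDegreeLE n (f i)) :
    HasDifferenceDegreeLE n fun x => ∑ i ∈ s, f i x := by
  classical
  induction s using Finset.induction_on with
  | empty => simpa using zero n
  | insert a s ha ih =>
    simp only [Finset.sum_insert ha]
    exact (hf a (Finset.mem_insert_self a s)).add
      (ih fun i hi => hf i (Finset.mem_insert_of_mem hi))

end HasDifferenceDegreeLE

/-- Expanding A(x + h, …, x + h) over subsets of the slots, the full subset cancels in the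
difference and every proper subset leaves a diagonal map of lower degree. Differences need not be
homogeneous, hence this notion of degree. -/
theorem MultilinearMap.hasDifferenceDegreeLE_diag {R E F : Type*} [CommRing R] [AddCommGroup E]
    [Module R E] [AddCommGroup F] [Module R F] {n : ℕ}
    (A : MultilinearMap R (fun _ : Fin n => E) F) :
    HasDifferenceDegreeLE n fun x => A fun _ => x := by
  classical
  induction n using Nat.strong_induction_on with
  | _ n ih =>
    rcases n with _ | n
    · intro x y
      exact congrArg A (Subsingleton.elim _ _)
    · intro h
      have key (x : E) : (A fun _ => x + h) - A (fun _ => x) =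
          ∑ s ∈ Finset.univ.erase (Finset.univ : Finset (Fin (n + 1))),
            (A.restr s rfl h) fun _ => x := by
        have h1 := A.map_add_univ (fun _ => x) (fun _ => h)
        rw [← Finset.add_sum_erase _ _ (Finset.mem_univ (Finset.univ : Finset (Fin (n + 1)))),
          Finset.piecewise_univ] at h1
        change (A fun _ => x + h) = _ at h1
        rw [h1, add_sub_cancel_left]
        refine Finset.sum_congr rfl fun s _ => ?_
        refine congrArg A (funext fun i => ?_)
        by_cases hi : i ∈ s <;> simp [hi]
      simp only [key]
      refine .sum _ fun s hs => ?_
      have hcard : s.card < n + 1 := by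
        simpa using (Finset.card_lt_iff_ne_univ s).2 (Finset.ne_of_mem_erase hs)
      exact (ih _ hcard _).mono (Nat.lt_succ_iff.1 hcard)

/-! ### Weak continuity on bounded sets and weakly Cauchy filters -/

section WeakContinuity

variable {𝕜 E F : Type*} [RCLike 𝕜] [NormedAddCommGroup E] [NormedSpace 𝕜 E]
  [NormedAddCommGroup F]

variable (𝕜) in
/-- Weak-to-norm continuity on bounded sets. -/
def IsWeaklyContOnBounded (f : E → F) : Prop :=
  ∀ B : Set E, Bornology.IsBounded B →
    ContinuousOn (fun y : WeakSpace 𝕜 E => f ((toWeakSpace 𝕜 E).symm y))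
      ((toWeakSpace 𝕜 E).symm ⁻¹' B)

theorem tendsto_toWeakSpace_iff {α : Type*} {l : Filter α} {u : α → E} {x : E} :
    Tendsto (fun a => toWeakSpace 𝕜 E (u a)) l (𝓝 (toWeakSpace 𝕜 E x)) ↔
      ∀ φ : StrongDual 𝕜 E, Tendsto (fun a => φ (u a)) l (𝓝 (φ x)) :=
  WeakBilin.tendsto_iff_forall_eval_tendsto (topDualPairing 𝕜 E).flip (by
    intro x y hxy
    refine (NormedSpace.inclusionInDoubleDualLi (E := E) 𝕜).injective ?_
    ext φ
    exact DFunLike.congr_fun hxy φ)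

namespace IsWeaklyContOnBounded

theorem tendsto {f : E → F} (hf : IsWeaklyContOnBounded 𝕜 f) {α : Type*} {l : Filter α}
    {u : α → E} {x : E} {R : ℝ} (hu : ∀ᶠ a in l, ‖u a‖ ≤ R) (hx : ‖x‖ ≤ R)
    (h : ∀ φ : StrongDual 𝕜 E, Tendsto (fun a => φ (u a)) l (𝓝 (φ x))) :
    Tendsto (fun a => f (u a)) l (𝓝 (f x)) := by
  have h1 := hf (Metric.closedBall 0 R) Metric.isBounded_closedBall (toWeakSpace 𝕜 E x)
    (by simpa using hx)
  have h2 : Tendsto (fun a => toWeakSpace 𝕜 E (u a)) l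
      (𝓝[(toWeakSpace 𝕜 E).symm ⁻¹' Metric.closedBall 0 R] (toWeakSpace 𝕜 E x)) :=
    tendsto_nhdsWithin_iff.2 ⟨tendsto_toWeakSpace_iff.2 h, by simpa using hu⟩
  simpa [Function.comp_def] using Tendsto.comp h1 h2

theorem comp_add_right {f : E → F} (hf : IsWeaklyContOnBounded 𝕜 f) (h : E) :
    IsWeaklyContOnBounded 𝕜 fun x => f (x + h) := by
  intro B hB
  have h1 : ContinuousOn (fun y : WeakSpace 𝕜 E => y + toWeakSpace 𝕜 E h)
      ((toWeakSpace 𝕜 E).symm ⁻¹' B) := by fun_prop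
  have hB' : Bornology.IsBounded ((fun x => x + h) '' B) := by
    obtain ⟨R, hR⟩ := hB.exists_norm_le
    refine isBounded_iff_forall_norm_le.2 ⟨R + ‖h‖, ?_⟩
    rintro _ ⟨x, hx, rfl⟩
    exact (norm_add_le _ _).trans (by linarith [hR x hx])
  refine ((hf _ hB').comp h1 ?_).congr ?_
  · intro y hy
    exact ⟨_, hy, rfl⟩
  · intro y _
    simp

theorem sub {f g : E → F} (hf : IsWeaklyContOnBounded 𝕜 f) (hg : IsWeaklyContOnBounded 𝕜 g) :
    IsWeaklyContOnBounded 𝕜 fun x => f x - g x :=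
  fun B hB => (hf B hB).sub (hg B hB)

/-- A vector-valued polynomial that is weakly continuous on bounded sets maps bounded weakly
Cauchy filters to Cauchy filters. -/
theorem cauchy_map {n : ℕ} {f : E → F} (hf : IsWeaklyContOnBounded 𝕜 f)
    (hn : HasDifferenceDegreeLE n f) {U : Filter E} [U.NeBot] {r : ℝ}
    (hU : Metric.closedBall (0 : E) r ∈ U)
    (hφ : ∀ φ : StrongDual 𝕜 E, ∃ a, Tendsto φ U (𝓝 a)) : Cauchy (map f U) := by
  induction n generalizing f U r with
  | zero =>
    have : f = fun _ => f 0 := funext fun x => hn x 0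
    rw [this]
    exact (tendsto_const_nhds (x := f 0) (f := U)).cauchy_map
  | succ n ih =>
    refine Metric.cauchy_iff.2 ⟨inferInstance, fun ε hε => ?_⟩
    have hball : ∀ᶠ x in U, ‖x‖ ≤ r := by
      filter_upwards [hU] with x hx
      simpa using hx
    -- The filter itself may have no weak limit in E, but its differences are bounded and weakly
    -- null.
    have hdiff : Tendsto (fun p : E × E => f (p.1 - p.2)) (U ×ˢ U) (𝓝 (f 0)) := by
      refine hf.tendsto (R := |r| + |r|) ?_ (by rw [norm_zero]; positivity) fun φ => ?_
      · filter_upwards [hball.prod_mk hball] with p hp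
        exact (norm_sub_le _ _).trans
          (add_le_add (hp.1.trans (le_abs_self r)) (hp.2.trans (le_abs_self r)))
      · obtain ⟨a, ha⟩ := hφ φ
        simpa using (ha.comp tendsto_fst).sub (ha.comp tendsto_snd)
    have h1 := (Metric.tendsto_nhds.1 hdiff (ε / 4) (by positivity))
    -- Fix the second variable: f(x - x₀) is close to f(0) for most x.
    obtain ⟨x₀, hx₀, hx₀r⟩ := (((eventually_swap_iff.1 h1).curry).and hball).exists
    let V : Filter E := map (fun x => x - x₀) U
    have hV : Metric.closedBall (0 : E) (r + ‖x₀‖) ∈ V := by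
      refine mem_map.2 ?_
      filter_upwards [hball] with x hx
      simpa using (norm_sub_le x x₀).trans (by linarith)
    have hVφ (φ : StrongDual 𝕜 E) : ∃ a, Tendsto φ V (𝓝 a) := by
      obtain ⟨a, ha⟩ := hφ φ
      refine ⟨a - φ x₀, tendsto_map'_iff.2 ?_⟩
      simpa [Function.comp_def] using ha.sub_const (φ x₀)
    -- The remaining part f(x) - f(x - x₀) is a difference of lower degree, evaluated along the
    -- translated filter.
    have hc := ih ((hf.comp_add_right x₀).sub hf) (hn x₀) hV hVφ
    obtain ⟨t, ht, hd⟩ := (Metric.cauchy_iff.1 hc).2 (ε / 2) (by positivity)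
    refine ⟨f '' ({x | f (x - x₀ + x₀) - f (x - x₀) ∈ t} ∩
      {x | dist (f (x - x₀)) (f 0) < ε / 4}), image_mem_map (inter_mem ht hx₀), ?_⟩
    rintro _ ⟨x, ⟨hx, hx'⟩, rfl⟩ _ ⟨y, ⟨hy, hy'⟩, rfl⟩
    have h2 := hd _ hx _ hy
    simp only [sub_add_cancel, Set.mem_ofPred_eq] at h2 hx' hy'
    have h3 := dist_triangle_right (f (x - x₀)) (f (y - x₀)) (f 0)
    calc dist (f x) (f y)
        = dist ((f x - f (x - x₀)) + f (x - x₀)) ((f y - f (y - x₀)) + f (y - x₀)) := by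
          simp only [sub_add_cancel]
      _ ≤ dist (f x - f (x - x₀)) (f y - f (y - x₀)) + dist (f (x - x₀)) (f (y - x₀)) :=
          dist_add_add_le _ _ _ _
      _ < ε := by linarith

end IsWeaklyContOnBounded

end WeakContinuity

/-! ### Test polynomials and limits of polynomials along ultrafilters -/

namespace ContHomPoly

variable {𝕜 E F : Type*} {n : ℕ} [RCLike 𝕜] [NormedAddCommGroup E] [NormedSpace 𝕜 E]
  [NormedAddCommGroup F] [NormedSpace 𝕜 F]

theorem norm_apply_le (P : ContHomPoly 𝕜 n E F) (x : E) : ‖P x‖ ≤ ‖P‖ * ‖x‖ ^ n := by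
  rcases eq_or_ne x 0 with rfl | hx
  · rcases n with _ | n
    · rw [pow_zero, mul_one]
      exact P.le_supNorm (x := 0) (by simp)
    · have := P.map_smul 0 0
      simp only [smul_zero, pow_succ, mul_zero, zero_smul] at this
      simp [this]
  · have hx' : 0 < ‖x‖ := norm_pos_iff.2 hx
    have h1 : ‖((‖x‖ : 𝕜)⁻¹) • x‖ ≤ 1 := (norm_smul_inv_norm hx).le
    have h2 := P.le_supNorm h1
    rw [map_smul, norm_smul, norm_pow, norm_inv, RCLike.norm_ofReal, abs_norm, inv_pow,
      inv_mul_le_iff₀ (by positivity), mul_comm] at h2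
    exact h2

theorem norm_le_of_forall {P : ContHomPoly 𝕜 n E F} {M : ℝ}
    (h : ∀ x, ‖x‖ ≤ 1 → ‖P x‖ ≤ M) : ‖P‖ ≤ M :=
  P.supNorm_le h

/-- The polynomial obtained by restricting a multilinear map to the diagonal. -/
def ofDiag (A : MultilinearMap 𝕜 (fun _ : Fin n => E) F)
    (hA : Continuous fun x => A fun _ => x) : ContHomPoly 𝕜 n E F :=
  ⟨fun x => A fun _ => x, hA,
    -- Averaging over permutations makes the map symmetric without changing its diagonal.
    (Nat.factorial n : 𝕜)⁻¹ • ∑ σ : Equiv.Perm (Fin n), A.domDomCongr σ, by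
    intro τ v
    simp only [_root_.smul_apply, sum_apply,
      MultilinearMap.domDomCongr_apply]
    congr 1
    exact Fintype.sum_equiv (Equiv.mulLeft τ) _ _ fun _ => rfl, by
    intro x
    have : (Nat.factorial n : 𝕜) ≠ 0 := by exact_mod_cast n.factorial_ne_zero
    simp only [_root_.smul_apply, sum_apply,
      MultilinearMap.domDomCongr_apply, Finset.sum_const, Finset.card_univ, Fintype.card_perm,
      Fintype.card_fin]
    rw [← Nat.cast_smul_eq_nsmul 𝕜, smul_smul, inv_mul_cancel₀ this, one_smul]⟩

/-- The homogeneous polynomial `x ↦ (ψ x) ^ m • T x`. -/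
def powSMul (m : ℕ) (ψ : StrongDual 𝕜 E) (T : E →L[𝕜] F) : ContHomPoly 𝕜 (m + 1) E F :=
  ofDiag (LinearMap.uncurryLeft
    { toFun := fun x => ((MultilinearMap.mkPiAlgebra 𝕜 (Fin m) 𝕜).compLinearMap
        fun _ => (ψ : E →ₗ[𝕜] 𝕜)).smulRight (T x)
      map_add' := fun x y => by ext; simp
      map_smul' := fun c x => by ext; simp [smul_smul, mul_comm] } :
    MultilinearMap 𝕜 (fun _ : Fin (m + 1) => E) F) (by
    have : Continuous fun x => ψ x ^ m • T x := by fun_prop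
    simpa [Fin.tail_def] using this)

@[simp]
theorem powSMul_apply (m : ℕ) (ψ : StrongDual 𝕜 E) (T : E →L[𝕜] F) (x : E) :
    powSMul m ψ T x = ψ x ^ m • T x := by
  change (LinearMap.uncurryLeft _ : MultilinearMap 𝕜 (fun _ : Fin (m + 1) => E) F) _ = _
  simp [Fin.tail_def]

theorem norm_powSMul_le (m : ℕ) (ψ : StrongDual 𝕜 E) (T : E →L[𝕜] F) :
    ‖powSMul m ψ T‖ ≤ ‖ψ‖ ^ m * ‖T‖ := by
  refine norm_le_of_forall fun x hx => ?_
  rw [powSMul_apply, norm_smul, norm_pow]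
  gcongr
  · exact ψ.unit_le_opNorm x hx
  · exact T.unit_le_opNorm x hx

theorem powSMul_smulRight_mem (m : ℕ) (ψ : StrongDual 𝕜 E) (y : F) :
    powSMul m ψ (ψ.smulRight y) ∈ weaklyContPoly 𝕜 (m + 1) E F := by
  intro B _
  have h : Continuous fun z : WeakSpace 𝕜 E => ψ ((toWeakSpace 𝕜 E).symm z) :=
    WeakBilin.eval_continuous (topDualPairing 𝕜 E).flip ψ
  refine Continuous.continuousOn ?_
  simp only [powSMul_apply, ContinuousLinearMap.smulRight_apply]
  exact (h.pow m).smul (h.smul continuous_const)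

/-- Weakly continuous polynomials converge in norm along bounded weakly Cauchy filters. -/
theorem exists_tendsto_of_mem_weaklyContPoly [CompleteSpace F] {P : ContHomPoly 𝕜 n E F}
    (hP : P ∈ weaklyContPoly 𝕜 n E F) {U : Filter E} [U.NeBot] {r : ℝ}
    (hU : Metric.closedBall (0 : E) r ∈ U)
    (hφ : ∀ φ : StrongDual 𝕜 E, ∃ a, Tendsto φ U (𝓝 a)) : ∃ y, Tendsto P U (𝓝 y) := by
  obtain ⟨-, A, -, hA⟩ := P.2
  have hdeg : HasDifferenceDegreeLE n P.1 := by
    rw [funext hA]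
    exact A.hasDifferenceDegreeLE_diag
  have hw : IsWeaklyContOnBounded 𝕜 P.1 := hP
  exact cauchy_map_iff_exists_tendsto.1 (hw.cauchy_map hdeg hU hφ)

/-- The weak-star limit in the bidual along an ultrafilter concentrated on a ball. -/
theorem exists_ultrafilterLimit {r : ℝ} {U : Ultrafilter E}
    (hU : Metric.closedBall (0 : E) r ∈ U) :
    ∃ L : ContHomPoly 𝕜 n E F → StrongDual 𝕜 (StrongDual 𝕜 F),
      (∀ P Q, L (P + Q) = L P + L Q) ∧ (∀ (c : 𝕜) P, L (c • P) = c • L P) ∧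
      (∀ P, ‖L P‖ ≤ r ^ n * ‖P‖) ∧
      ∀ (P : ContHomPoly 𝕜 n E F) (φ : StrongDual 𝕜 F),
        Tendsto (fun x => φ (P x)) U (𝓝 (L P φ)) := by
  have key (P : ContHomPoly 𝕜 n E F) : ∃ Λ : StrongDual 𝕜 (StrongDual 𝕜 F),
      ‖Λ‖ ≤ r ^ n * ‖P‖ ∧ ∀ φ : StrongDual 𝕜 F, Tendsto (fun x => φ (P x)) U (𝓝 (Λ φ)) := by
    let j : E → WeakDual 𝕜 (StrongDual 𝕜 F) := fun x =>
      StrongDual.toWeakDual (NormedSpace.inclusionInDoubleDual 𝕜 F (P x))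
    -- Banach–Alaoglu in F** supplies the limit of the bounded image ultrafilter.
    obtain ⟨Λ, hΛ, ht⟩ := (WeakDual.isCompact_closedBall (𝕜 := 𝕜) (E := StrongDual 𝕜 F)
      0 (r ^ n * ‖P‖)).ultrafilter_le_nhds (U.map j) (by
        refine le_principal_iff.2 ?_
        change j ⁻¹' _ ∈ U
        filter_upwards [hU] with x hx
        have hx' : ‖x‖ ≤ r := by simpa using hx
        have h1 : ‖NormedSpace.inclusionInDoubleDual 𝕜 F (P x)‖ ≤ r ^ n * ‖P‖ := by
          refine (NormedSpace.double_dual_bound 𝕜 F (P x)).trans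
            ((P.norm_apply_le x).trans ?_)
          rw [mul_comm]
          gcongr
        exact (mem_closedBall_zero_iff
          (a := NormedSpace.inclusionInDoubleDual 𝕜 F (P x))).2 h1)
    refine ⟨WeakDual.toStrongDual Λ, 
      (mem_closedBall_zero_iff (a := WeakDual.toStrongDual Λ)).1 hΛ, fun φ => ?_⟩
    exact ((WeakDual.eval_continuous φ).tendsto Λ).comp ht
  choose L hL ht using key
  refine ⟨L, fun P Q => ?_, fun c P => ?_, hL, ht⟩
  · ext φ
    refine tendsto_nhds_unique (ht (P + Q) φ) ?_
    simpa using (ht P φ).add (ht Q φ)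
  · ext φ
    refine tendsto_nhds_unique (ht (c • P) φ) ?_
    simpa using (ht P φ).const_mul c

end ContHomPoly

/-! ### Transfer of the M(1,C) inequality -/

section Transfer

variable {𝕜 F G X : Type*} [RCLike 𝕜] [NormedAddCommGroup F] [NormedSpace 𝕜 F]
  [NormedAddCommGroup G] [NormedSpace 𝕜 G] [NormedAddCommGroup X] [NormedSpace 𝕜 X]

/-- The norm need not be attained, so all norm tests below are made along such a sequence. -/
theorem exists_seq_tendsto_norm (ξ : StrongDual 𝕜 F) :
    ∃ ψ : ℕ → F, (∀ k, ‖ψ k‖ ≤ 1) ∧ Tendsto (fun k => ‖ξ (ψ k)‖) atTop (𝓝 ‖ξ‖) := by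
  have h (k : ℕ) : ∃ x, ‖x‖ < 1 ∧ ‖ξ‖ - 1 / ((k : ℝ) + 1) < ‖ξ x‖ :=
    ξ.exists_lt_apply_of_lt_opNorm (sub_lt_self _ (by positivity))
  choose ψ h1 h2 using h
  refine ⟨ψ, fun k => (h1 k).le, ?_⟩
  refine tendsto_of_tendsto_of_tendsto_of_le_of_le ?_ tendsto_const_nhds
    (fun k => (h2 k).le) fun k => ξ.unit_le_opNorm _ (h1 k).le
  simpa using (tendsto_one_div_add_atTop_nhds_zero_nat (𝕜 := ℝ)).const_sub ‖ξ‖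

/-- A linear norm-preserving extension operator `κ` from the dual of a subspace gives an ideal
projection. -/
theorem isIdealProjection_comp_precomp {ι : F →L[𝕜] G} (hι : ‖ι‖ ≤ 1)
    {κ : StrongDual 𝕜 F →L[𝕜] StrongDual 𝕜 G} (hκ : ∀ φ, ‖κ φ‖ ≤ ‖φ‖)
    (hκι : ∀ φ y, κ φ (ι y) = φ y) :
    IsIdealProjection (LinearMap.range (ι : F →ₗ[𝕜] G))
      (κ.comp (ContinuousLinearMap.precomp 𝕜 ι)) where
  idem f := congrArg κ (ContinuousLinearMap.ext fun y => hκι _ y)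
  ker_eq f := by
    constructor
    · rintro hf _ ⟨y, rfl⟩
      have h1 : κ (f.comp ι) (ι y) = 0 := DFunLike.congr_fun hf (ι y)
      rwa [hκι] at h1
    · intro h
      have h0 : f.comp ι = 0 := ContinuousLinearMap.ext fun y => h _ ⟨y, rfl⟩
      change κ (f.comp ι) = 0
      rw [h0, map_zero]
  norm_le := ContinuousLinearMap.opNorm_le_bound _ zero_le_one fun f => by
    rw [one_mul]
    exact (hκ (f.comp ι)).trans ((f.opNorm_comp_le ι).trans
      (mul_le_of_le_one_right (norm_nonneg f) hι))

/-- An operator `L` from a space with an `M(1,C)`-ideal `J` into `G ⊇ F` that maps `J` into `F`,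
and for which functionals on `F` pulled back along `L` attain their norms on `J`, transfers the
ideal inequality to elements of `G` in the range of `L`. -/
theorem IsMOneIdeal.transfer {C : ℝ}
    (hC : 0 < C) {J : Submodule 𝕜 X} (h : IsMOneIdeal 𝕜 X C J) (ι : F →L[𝕜] G)
    (L : X → G) (hadd : ∀ P Q, L (P + Q) = L P + L Q)
    (hsmul : ∀ (c : 𝕜) P, L (c • P) = c • L P) {M : ℝ} (hM : 0 ≤ M)
    (hL : ∀ P, ‖L P‖ ≤ M * ‖P‖) (hJ : ∀ P ∈ J, ∃ y, L P = ι y)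
    {c : ℕ → 𝕜} (hc : Tendsto (fun k => ‖c k‖) atTop (𝓝 M))
    (hJc : ∀ k y, ∃ P ∈ J, ‖P‖ ≤ ‖y‖ ∧ L P = c k • ι y)
    {η : G} {N : ℝ} {d : ℕ → 𝕜} (hd : Tendsto (fun k => ‖d k‖) atTop (𝓝 N))
    (hη : ∀ k, ∃ P : X, ‖P‖ ≤ 1 ∧ L P = d k • η)
    {f g : StrongDual 𝕜 G} (hg : ‖g‖ ≤ ‖f.comp ι‖) (hfg : ∀ y, g (ι y) = f (ι y)) :
    M * ‖g‖ + C * (N * ‖f η - g η‖) ≤ M * ‖f‖ := by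
  obtain ⟨-, Q, hQ, hQC⟩ := h
  obtain ⟨Λ, hΛ⟩ : ∃ Λ : X →L[𝕜] G, ∀ P, Λ P = L P :=
    ⟨LinearMap.mkContinuous ⟨⟨L, hadd⟩, hsmul⟩ M hL, fun _ => rfl⟩
  have hbound (u : StrongDual 𝕜 G) : ‖u.comp Λ‖ ≤ M * ‖u‖ := by
    refine ContinuousLinearMap.opNorm_le_bound _ (by positivity) fun P => ?_
    rw [ContinuousLinearMap.comp_apply, hΛ]
    calc ‖u (L P)‖ ≤ ‖u‖ * ‖L P‖ := u.le_opNorm _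
      _ ≤ ‖u‖ * (M * ‖P‖) := by gcongr; exact hL P
      _ = M * ‖u‖ * ‖P‖ := by ring
  -- The kernel of `Q` is the annihilator of `J`, so `Q u` depends only on `u` restricted to `J`.
  have hQeq {u v : StrongDual 𝕜 X} (huv : ∀ P ∈ J, u P = v P) : Q u = Q v := by
    rw [← sub_eq_zero, ← map_sub, hQ.ker_eq]
    intro P hP
    rw [sub_apply, huv P hP, sub_self]
  have hQJ (u : StrongDual 𝕜 X) (P : X) (hP : P ∈ J) : Q u P = u P := by
    have h0 : Q (u - Q u) = 0 := by rw [map_sub, hQ.idem, sub_self]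
    have h1 := (hQ.ker_eq _).1 h0 P hP
    rw [sub_apply, sub_eq_zero] at h1
    exact h1.symm
  have hlower : M * ‖g‖ ≤ ‖Q (g.comp Λ)‖ := by
    have hM' := mul_le_mul_of_nonneg_left hg hM
    refine hM'.trans (le_of_tendsto' (hc.mul_const ‖f.comp ι‖) fun k => ?_)
    rw [← norm_smul]
    refine ContinuousLinearMap.opNorm_le_bound _ (norm_nonneg _) fun y => ?_
    obtain ⟨P, hPJ, hPy, hP⟩ := hJc k y
    have h1 : (c k • f.comp ι) y = Q (g.comp Λ) P := by
      rw [hQJ _ P hPJ, ContinuousLinearMap.comp_apply, hΛ, hP, map_smul, hfg]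
      rfl
    rw [h1]
    exact ((Q (g.comp Λ)).le_opNorm P).trans (by gcongr)
  -- `hlower` leaves no room in the ideal inequality for a nonzero g∘Λ - Q(g∘Λ), since ‖g∘Λ‖ ≤ M‖g‖
  -- and C > 0.
  have hfix : Q (g.comp Λ) = g.comp Λ := by
    have h1 := hQC (g.comp Λ)
    have h2 : C * ‖g.comp Λ - Q (g.comp Λ)‖ ≤ 0 := by linarith [hbound g]
    have h3 : ‖g.comp Λ - Q (g.comp Λ)‖ ≤ 0 := nonpos_of_mul_nonpos_right h2 hC
    exact (sub_eq_zero.1 (norm_le_zero_iff.1 h3)).symm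
  have hQf : Q (f.comp Λ) = g.comp Λ := by
    rw [← hfix]
    refine hQeq fun P hP => ?_
    obtain ⟨y, hy⟩ := hJ P hP
    simp only [ContinuousLinearMap.comp_apply, hΛ, hy, hfg]
  have hupper : N * ‖f η - g η‖ ≤ ‖f.comp Λ - g.comp Λ‖ := by
    refine le_of_tendsto' (hd.mul_const _) fun k => ?_
    obtain ⟨P, hP1, hP⟩ := hη k
    have h1 : d k • (f η - g η) = (f.comp Λ - g.comp Λ) P := by
      rw [sub_apply, ContinuousLinearMap.comp_apply, ContinuousLinearMap.comp_apply, hΛ, hP,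
        map_smul, map_smul, smul_sub]
    rw [← norm_smul, h1]
    exact ContinuousLinearMap.unit_le_opNorm _ P hP1
  have h1 := hQC (f.comp Λ)
  rw [hQf] at h1
  rw [hfix] at hlower
  have h2 := mul_le_mul_of_nonneg_left hupper hC.le
  linarith [hbound f]

/-- A linear operator `L` from `X` to `G`, of norm at most `r ^ (m + 1)` for some `r ≤ ‖η‖`, that
maps `J` into the range of `ι`, with `J` and `X` containing almost norm-attaining lifts of the
elements of the range of `ι`, respectively of `η`. -/
structure IsIdealLift (J : Submodule 𝕜 X) (ι : F →L[𝕜] G) (η : G) (m : ℕ) (r : ℝ) (c : ℕ → 𝕜)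
    (L : X → G) : Prop where
  pos : 0 < r
  le_norm : r ≤ ‖η‖
  add : ∀ P Q, L (P + Q) = L P + L Q
  smul : ∀ (a : 𝕜) P, L (a • P) = a • L P
  bound : ∀ P, ‖L P‖ ≤ r ^ (m + 1) * ‖P‖
  maps_mem : ∀ P ∈ J, ∃ y, L P = ι y
  tendsto : Tendsto (fun k => ‖c k‖) atTop (𝓝 r)
  lift_mem : ∀ k y, ∃ P ∈ J, ‖P‖ ≤ ‖y‖ ∧ L P = c k ^ (m + 1) • ι y
  lift : ∀ k, ∃ P : X, ‖P‖ ≤ 1 ∧ L P = c k ^ m • η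

/-- A norm-preserving extension operator makes a closed subspace of `G` an `M(1,C)`-ideal, once
every nonzero element of `G` has a lift to a space with an `M(1,C)`-ideal. -/
theorem IsMOneIdeal.range_of_lift {C : ℝ} (hC : 0 < C) {J : Submodule 𝕜 X}
    (h : IsMOneIdeal 𝕜 X C J) {ι : F →L[𝕜] G} (hι : ‖ι‖ ≤ 1)
    (hcl : IsClosed (LinearMap.range (ι : F →ₗ[𝕜] G) : Set G))
    {κ : StrongDual 𝕜 F →L[𝕜] StrongDual 𝕜 G} (hκ : ∀ φ, ‖κ φ‖ ≤ ‖φ‖)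
    (hκι : ∀ φ y, κ φ (ι y) = φ y)
    (hlift : ∀ η : G, η = 0 ∨ ∃ m r c L, IsIdealLift J ι η m r c L) :
    IsMOneIdeal 𝕜 G C (LinearMap.range (ι : F →ₗ[𝕜] G)) := by
  refine ⟨hcl, _, isIdealProjection_comp_precomp hι hκ hκι, fun f => ?_⟩
  have hf : ‖κ (f.comp ι)‖ ≤ ‖f‖ := (hκ _).trans ((f.opNorm_comp_le ι).trans
      (mul_le_of_le_one_right (norm_nonneg f) hι))
  have key (η : G) : C * ‖f η - κ (f.comp ι) η‖ ≤ (‖f‖ - ‖κ (f.comp ι)‖) * ‖η‖ := by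
    rcases hlift η with rfl | ⟨m, r, c, L, hL⟩
    · simp
    · have h1 := h.transfer hC ι L hL.add hL.smul (pow_nonneg hL.pos.le (m + 1)) hL.bound
        hL.maps_mem (c := fun k => c k ^ (m + 1)) (d := fun k => c k ^ m) (N := r ^ m)
        (by simpa only [norm_pow] using hL.tendsto.pow (m + 1)) hL.lift_mem
        (by simpa only [norm_pow] using hL.tendsto.pow m) hL.lift (hκ (f.comp ι))
        (fun y => hκι _ y)
      -- Cancelling r^m leaves a single factor r, which `le_norm` replaces by ‖η‖.
      rw [pow_succ, mul_assoc, mul_assoc, mul_left_comm C, ← mul_add] at h1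
      have h2 := le_of_mul_le_mul_left h1 (pow_pos hL.pos m)
      have h3 := mul_le_mul_of_nonneg_left hL.le_norm (sub_nonneg.2 hf)
      linarith
  have h1 : ‖f - κ (f.comp ι)‖ ≤ (‖f‖ - ‖κ (f.comp ι)‖) / C := by
    refine ContinuousLinearMap.opNorm_le_bound _ (div_nonneg (sub_nonneg.2 hf) hC.le) fun η => ?_
    rw [div_mul_eq_mul_div, le_div_iff₀ hC, mul_comm]
    exact key η
  rw [le_div_iff₀ hC] at h1
  change ‖κ (f.comp ι)‖ + C * ‖f - κ (f.comp ι)‖ ≤ ‖f‖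
  linarith

end Transfer

/-! ### Metric quotient maps and biduals -/

section Quotient

variable {𝕜 E F : Type*} [RCLike 𝕜] [NormedAddCommGroup E] [NormedSpace 𝕜 E]
  [NormedAddCommGroup F] [NormedSpace 𝕜 F] {ρ : E →L[𝕜] F}

theorem IsMetricQuotientMap.norm_le_one (hρ : IsMetricQuotientMap ρ) : ‖ρ‖ ≤ 1 := by
  by_contra! h
  obtain ⟨x, hx, h1⟩ := ρ.exists_lt_apply_of_lt_opNorm h
  have h2 : ρ x ∈ Metric.ball (0 : F) 1 := hρ ▸ ⟨x, by simpa using hx, rfl⟩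
  exact absurd h1 (not_lt.2 (by simpa using h2 : ‖ρ x‖ < 1).le)

theorem IsMetricQuotientMap.norm_comp (hρ : IsMetricQuotientMap ρ) (φ : StrongDual 𝕜 F) :
    ‖φ.comp ρ‖ = ‖φ‖ := by
  refine le_antisymm ((φ.opNorm_comp_le ρ).trans
    (mul_le_of_le_one_right (norm_nonneg φ) hρ.norm_le_one)) ?_
  by_contra! h
  obtain ⟨y, hy, h1⟩ := φ.exists_lt_apply_of_lt_opNorm h
  have h2 : y ∈ ρ '' Metric.ball (0 : E) 1 := hρ.symm ▸ (by simpa using hy)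
  obtain ⟨x, hx, rfl⟩ := h2
  exact absurd h1 (not_lt.2 ((φ.comp ρ).unit_le_opNorm x (by simpa using (mem_ball_zero_iff.1 hx).le)))

/-- Functionals extend along linear isometries without increasing the norm. -/
theorem LinearIsometry.exists_dual_extension (R : F →ₗᵢ[𝕜] E) (η : StrongDual 𝕜 F) :
    ∃ ξ : StrongDual 𝕜 E, ‖ξ‖ ≤ ‖η‖ ∧ ∀ φ, ξ (R φ) = η φ := by
  let e := R.equivRange
  let g : StrongDual 𝕜 (LinearMap.range R.toLinearMap) :=
    η.comp (e.symm.toContinuousLinearEquiv : LinearMap.range R.toLinearMap →L[𝕜] F)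
  obtain ⟨ξ, hξ, hn⟩ := exists_extension_norm_eq _ g
  refine ⟨ξ, hn.trans_le ?_, fun φ => ?_⟩
  · refine ContinuousLinearMap.opNorm_le_bound _ (norm_nonneg η) fun z => ?_
    have h1 := η.le_opNorm (e.symm z)
    rwa [e.symm.norm_map] at h1
  · have h1 := hξ (e φ)
    have h2 : g (e φ) = η φ := congrArg η (e.symm_apply_apply φ)
    rw [h2] at h1
    exact h1

/-- The bidual of a metric quotient map lifts elements without increasing the norm. -/
theorem IsMetricQuotientMap.exists_bidual_lift (hρ : IsMetricQuotientMap ρ)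
    (η : StrongDual 𝕜 (StrongDual 𝕜 F)) :
    ∃ ξ : StrongDual 𝕜 (StrongDual 𝕜 E), ‖ξ‖ ≤ ‖η‖ ∧
      ∀ φ : StrongDual 𝕜 F, ξ (φ.comp ρ) = η φ := by
  obtain ⟨ξ, hξ, h⟩ := LinearIsometry.exists_dual_extension (𝕜 := 𝕜)
    { toFun := fun φ : StrongDual 𝕜 F => φ.comp ρ
      map_add' := fun _ _ => rfl
      map_smul' := fun _ _ => rfl
      norm_map' := hρ.norm_comp } η
  exact ⟨ξ, hξ, h⟩

end Quotient

/-! ### Construction of the lifts and conclusion -/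

/-- The operator is the weak* limit along an ultrafilter converging to a lift ξ of η; the lifts are
ψ^(m+1) y for y in F and ψ^m ρ for η, with ψ nearly norming ξ. -/
theorem IsMetricQuotientMap.exists_isIdealLift {𝕜 E F : Type*} [RCLike 𝕜]
    [NormedAddCommGroup E] [NormedSpace 𝕜 E] [NormedAddCommGroup F] [NormedSpace 𝕜 F]
    [CompleteSpace F] {ρ : E →L[𝕜] F} (hρ : IsMetricQuotientMap ρ) (m : ℕ)
    (η : StrongDual 𝕜 (StrongDual 𝕜 F)) :
    η = 0 ∨ ∃ m' r c L, IsIdealLift (weaklyContPoly 𝕜 (m + 1) E F)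
      (NormedSpace.inclusionInDoubleDual 𝕜 F) η m' r c L := by
  obtain ⟨ξ, hξη, hξ⟩ := hρ.exists_bidual_lift η
  rcases eq_or_ne ξ 0 with rfl | h0
  · exact Or.inl (ContinuousLinearMap.ext fun φ => (hξ φ).symm)
  have hr : 0 < ‖ξ‖ := (norm_nonneg ξ).lt_of_ne' (norm_ne_zero_iff (a := ξ) |>.2 h0)
  obtain ⟨U, hU, hUξ⟩ := exists_ultrafilter_tendsto_bidual ξ
  obtain ⟨L, hadd, hsmul, hL, hlim⟩ := ContHomPoly.exists_ultrafilterLimit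
    (𝕜 := 𝕜) (F := F) (n := m + 1) hU
  obtain ⟨ψ, hψ, hψξ⟩ := exists_seq_tendsto_norm ξ
  refine Or.inr ⟨m, ‖ξ‖, fun k => ξ (ψ k), L, hr, hξη, hadd, hsmul, hL, ?_, hψξ, ?_, ?_⟩
  · intro P hP
    obtain ⟨y, hy⟩ := ContHomPoly.exists_tendsto_of_mem_weaklyContPoly hP hU
      fun φ => ⟨_, hUξ φ⟩
    exact ⟨y, ContinuousLinearMap.ext fun φ =>
      tendsto_nhds_unique (hlim P φ) ((φ.continuous.tendsto y).comp hy)⟩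
  · intro k y
    refine ⟨_, ContHomPoly.powSMul_smulRight_mem m (ψ k) y, ?_, ?_⟩
    · refine (ContHomPoly.norm_powSMul_le _ _ _).trans ?_
      rw [ContinuousLinearMap.norm_smulRight_apply, ← mul_assoc, ← pow_succ]
      exact mul_le_of_le_one_left (norm_nonneg y) (pow_le_one₀ (norm_nonneg _) (hψ k))
    · ext φ
      refine tendsto_nhds_unique (hlim _ φ) ?_
      have := ((hUξ (ψ k)).pow (m + 1)).mul_const (φ y)
      simpa [pow_succ, mul_assoc] using this
  · intro k
    refine ⟨ContHomPoly.powSMul m (ψ k) ρ, ?_, ?_⟩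
    · refine (ContHomPoly.norm_powSMul_le _ _ _).trans ?_
      exact mul_le_one₀ (pow_le_one₀ (norm_nonneg _) (hψ k)) (norm_nonneg _) hρ.norm_le_one
    · ext φ
      refine tendsto_nhds_unique (hlim _ φ) ?_
      have := ((hUξ (ψ k)).pow m).mul (hUξ (φ.comp ρ))
      rw [hξ] at this
      simpa using this

theorem proposition4p6 {𝕜 E F : Type*} [RCLike 𝕜]
    [NormedAddCommGroup E] [NormedSpace 𝕜 E] [CompleteSpace E]
    [NormedAddCommGroup F] [NormedSpace 𝕜 F] [CompleteSpace F]
    (hρ : ∃ ρ : E →L[𝕜] F, IsMetricQuotientMap ρ)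
    (n : ℕ) (hn : 1 ≤ n) (C : ℝ) (hC : 0 < C)
    (h : IsMOneIdeal 𝕜 (ContHomPoly 𝕜 n E F) C (weaklyContPoly 𝕜 n E F)) :
    IsMOneIdeal 𝕜 (StrongDual 𝕜 (StrongDual 𝕜 F)) C (canonicalCopy 𝕜 F) := by
  obtain ⟨ρ, hρ⟩ := hρ
  -- One of the n factors is reserved for ρ in ψ^m ρ, hence n ≥ 1.
  obtain ⟨m, rfl⟩ : ∃ m, n = m + 1 := ⟨n - 1, by omega⟩
  have hcl : IsClosed (canonicalCopy 𝕜 F : Set (StrongDual 𝕜 (StrongDual 𝕜 F))) :=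
    (LinearIsometry.isometry (NormedSpace.inclusionInDoubleDualLi (E := F) 𝕜)).isUniformInducing
      |>.isComplete_range.isClosed
  exact h.range_of_lift hC (NormedSpace.inclusionInDoubleDual_norm_le 𝕜 F) hcl
    -- The extension operator is the canonical embedding of F* into F***.
    (κ := NormedSpace.inclusionInDoubleDual 𝕜 (StrongDual 𝕜 F))
    (NormedSpace.double_dual_bound 𝕜 (StrongDual 𝕜 F)) (fun _ _ => rfl)
    (hρ.exists_isIdealLift m)
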